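/- All rings are commutative with $1$. Let $k$ be a ring and let $I$ be a well-ordered set; let $I_s\subseteq I$ be the set of successors, i.e. of the elements $i$ having an immediate predecessor, and write $j\lessdot i$ if $j$ is the immediate predecessor of $i$. For a ring $R$ let $R^{\oplus I_s}$ be the free $R$-module with standard basis $(e_j)_{j\in I_s}$. An $I$-flag in an $R$-module $M$ is an order-preserving map $F$ from $I$ to the submodules of $M$ such that: $F_p=0$ for some $p\in I$ and $F_q=M$ for some $q\in I$; each $F_i$ is a direct summand of $M$; $F_i/F_j$ is finitely generated projective of constant rank $1$ whenever $j\lessdot i$; and $F_i=\sum_{j<i}F_j$ whenever $i$ has no immediate predecessor. A $k$-functor is a functor from $k$-algebras to sets. The flag functor $\mathrm{Fl}_I$ is the $k$-functor that sends $R$ to the set of $I$-flags in $R^{\oplus I_s}$ and sends a $k$-algebra homomorphism $\varphi:R\to S$ to the map $F\mapsto(i\mapsto$ the $S$-submodule of $S^{\oplus I_s}$ spanned by the coordinatewise image of $F_i$ under $\varphi)$. Let $\mathrm{GL}_{I_s}(R)$ be the group of invertible column-finite $I_s\times I_s$ matrices over $R$ (equivalently, the automorphisms of $R^{\oplus I_s}$),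 and let $B(R)$ be its subset of upper triangular matrices, i.e. those whose $(i,j)$ entry is $0$ for $i>j$. Let $E_i=\mathrm{span}_R(e_j : j\in I_s,\ j\le i)$ for $i\in I$. For $\sigma\in\mathrm{Perm}(I_s)$ write $\sigma$ also for the permutation matrix $e_j\mapsto e_{\sigma(j)}$, let $B\sigma E$ be the subfunctor of $\mathrm{Fl}_I$ given by $$(B\sigma E)(R)=\{F\in \mathrm{Fl}_I(R) : F=b\sigma E \text{ for some } b\in B(R)\},$$ and let the Schubert cell $X^\circ_\sigma=\mathrm{sh}(B\sigma E)$ be the subfunctor of $\mathrm{Fl}_I$ given by $$X^\circ_\sigma(R)=\{F\in \mathrm{Fl}_I(R) : \text{there is a faithfully flat, finitely presented $k$-algebra homomorphism } \varphi:R\to S \text{ with } \mathrm{Fl}_I(\varphi)(F)\in (B\sigma E)(S)\}.$$ **Theorem (The Functorial Bruhat Decomposition).** The subfunctors $X^\circ_\sigma$, $\sigma\in\mathrm{Perm}(I_s)$, of $\mathrm{Fl}_I$ are pairwise disjoint, i.e. $X^\circ_\sigma(R)\cap X^\circ_\tau(R)=\emptyset$ for all $\sigma\ne\tau$ and every nonzero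 $k$-algebra $R$. They cover $\mathrm{Fl}_I$, i.e. for every $k$-algebra $R$ that is a field, $\mathrm{Fl}_I(R)=\bigcup_{\sigma\in\mathrm{Perm}(I_s)}X^\circ_\sigma(R)$. -/

import Mathlib

open CategoryTheory
open scoped TensorProduct

universe u v w

namespace FlagSpace

noncomputable section

section Flags

/-- The set `I_s` of successors of `I`, i.e. of the elements which have an immediate predecessor. -/
abbrev Succs (I : Type w) [LinearOrder I] : Type w := {i : I // ∃ j, j ⋖ i}

/-- The quotient `N / L` for nested submodules `L ≤ N`. -/
abbrev SubQuot {R : Type v} {M : Type*} [CommRing R] [AddCommGroup M] [Module R M]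
    (N L : Submodule R M) : Type _ := N ⧸ L.submoduleOf N

/-- An `I`-flag in an `R`-module `M`. -/
structure IsFlag {I : Type w} [LinearOrder I] {R : Type v} [CommRing R] {M : Type*}
    [AddCommGroup M] [Module R M] (F : I → Submodule R M) : Prop where
  exists_bot : ∃ i, F i = ⊥
  exists_top : ∃ i, F i = ⊤
  mono : Monotone F
  /-- every `F i` is a direct summand -/
  summand : ∀ i, ∃ N, IsCompl (F i) N
  /-- successive quotients are finitely generated projective of constant rank one -/
  finite : ∀ i j, i ⋖ j → Module.Finite R (SubQuot (F j) (F i))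
  projective : ∀ i j, i ⋖ j → Module.Projective R (SubQuot (F j) (F i))
  rank_one : ∀ i j, i ⋖ j → ∀ p : PrimeSpectrum R,
    Module.rankAtStalk (SubQuot (F j) (F i)) p = 1
  /-- `F` is continuous at the elements without a predecessor -/
  limit : ∀ i, (¬ ∃ j, j ⋖ i) → ⨆ j, ⨆ _ : j < i, F j = F i

end Flags

section BaseChange

variable {ι : Type w} {R S T : Type v} [CommRing R] [CommRing S] [CommRing T]

/-- The coordinatewise map `φ^ι : R^{⊕ι} → S^{⊕ι}`. -/
def coordMap (φ : R →+* S) : (ι →₀ R) →+ (ι →₀ S) :=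
  Finsupp.mapRange.addMonoidHom (φ : R →+ S)

/-- Base change of submodules of a free module: the image of `N ⊗_R S` in
`R^{⊕ι} ⊗_R S = S^{⊕ι}`, i.e. the `S`-submodule spanned by the image of `N`. -/
def baseChange (φ : R →+* S) (N : Submodule R (ι →₀ R)) : Submodule S (ι →₀ S) :=
  Submodule.span S (coordMap φ '' N)

lemma coordMap_single (φ : R →+* S) (i : ι) (a : R) :
    coordMap φ (Finsupp.single i a) = Finsupp.single i (φ a) := by
  simp [coordMap]

lemma coordMap_smul (φ : R →+* S) (a : R) (x : ι →₀ R) :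
    coordMap φ (a • x) = φ a • coordMap φ x := by
  ext i; simp [coordMap]

lemma coordMap_mem (φ : R →+* S) {N : Submodule R (ι →₀ R)} {x : ι →₀ R} (hx : x ∈ N) :
    coordMap φ x ∈ baseChange φ N := Submodule.subset_span ⟨x, hx, rfl⟩

lemma baseChange_mono (φ : R →+* S) {N N' : Submodule R (ι →₀ R)} (h : N ≤ N') :
    baseChange φ N ≤ baseChange φ N' := Submodule.span_mono (Set.image_mono h)

lemma baseChange_le (φ : R →+* S) {N : Submodule R (ι →₀ R)} {P : Submodule S (ι →₀ S)} :
    baseChange φ N ≤ P ↔ ∀ x ∈ N, coordMap φ x ∈ P := by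
  simp [baseChange, Submodule.span_le, Set.subset_def]

lemma baseChange_bot (φ : R →+* S) : baseChange φ (⊥ : Submodule R (ι →₀ R)) = ⊥ := by
  rw [eq_bot_iff, baseChange_le]
  rintro x hx
  rw [Submodule.mem_bot] at hx
  simp [hx]

/-- Base change of the span of a family. -/
lemma baseChange_span (φ : R →+* S) (s : Set (ι →₀ R)) :
    baseChange φ (Submodule.span R s) = Submodule.span S (coordMap φ '' s) := by
  apply le_antisymm
  · rw [baseChange_le]
    intro x hx
    induction hx using Submodule.span_induction with
    | mem x h => exact Submodule.subset_span ⟨x, h, rfl⟩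
    | zero => simp
    | add x y _ _ hx hy => rw [map_add]; exact add_mem hx hy
    | smul a x _ hx => rw [coordMap_smul]; exact Submodule.smul_mem _ _ hx
  · exact Submodule.span_mono (Set.image_mono Submodule.subset_span)

lemma baseChange_top (φ : R →+* S) : baseChange φ (⊤ : Submodule R (ι →₀ R)) = ⊤ := by
  rw [eq_top_iff]
  intro x _
  induction x using Finsupp.induction_linear with
  | zero => simp
  | add x y hx hy => exact add_mem (hx trivial) (hy trivial)
  | single i a =>
    have : Finsupp.single i a = a • coordMap φ (Finsupp.single i (1 : R)) := by
      simp [coordMap_single]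
    rw [this]
    exact Submodule.smul_mem _ _ (coordMap_mem φ trivial)

lemma baseChange_iSup (φ : R →+* S) {κ : Sort*} (N : κ → Submodule R (ι →₀ R)) :
    baseChange φ (⨆ a, N a) = ⨆ a, baseChange φ (N a) := by
  apply le_antisymm
  · rw [baseChange_le]
    intro x hx
    induction hx using Submodule.iSup_induction' with
    | mem a x hx => exact Submodule.mem_iSup_of_mem a (coordMap_mem φ hx)
    | zero => simp
    | add x y _ _ hx hy => rw [map_add]; exact add_mem hx hy
  · exact iSup_le fun a => baseChange_mono φ (le_iSup N a)

lemma baseChange_id (N : Submodule R (ι →₀ R)) : baseChange (RingHom.id R) N = N := by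
  have : ∀ x : ι →₀ R, coordMap (RingHom.id R) x = x := by
    intro x; ext i; simp [coordMap]
  apply le_antisymm
  · rw [baseChange_le]; intro x hx; rwa [this]
  · intro x hx
    rw [← this x]
    exact coordMap_mem _ hx

lemma coordMap_comp (φ : R →+* S) (ψ : S →+* T) (x : ι →₀ R) :
    coordMap (ψ.comp φ) x = coordMap ψ (coordMap φ x) := by
  ext i; simp [coordMap]

lemma baseChange_comp (φ : R →+* S) (ψ : S →+* T) (N : Submodule R (ι →₀ R)) :
    baseChange (ψ.comp φ) N = baseChange ψ (baseChange φ N) := by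
  apply le_antisymm
  · rw [baseChange_le]
    intro x hx
    rw [coordMap_comp]
    exact coordMap_mem ψ (coordMap_mem φ hx)
  · have h := (baseChange_span ψ (coordMap φ '' (N : Set (ι →₀ R)))).le
    refine h.trans (Submodule.span_le.2 ?_)
    rintro _ ⟨_, ⟨x, hx, rfl⟩, rfl⟩
    rw [← coordMap_comp]
    exact coordMap_mem _ hx

/-- The base change of a linear endomorphism of `R^{⊕ι}` (entrywise on matrices). -/
def mapEnd (φ : R →+* S) (g : (ι →₀ R) →ₗ[R] (ι →₀ R)) :
    (ι →₀ S) →ₗ[S] (ι →₀ S) :=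
  Finsupp.linearCombination S fun i => coordMap φ (g (Finsupp.single i 1))

lemma mapEnd_coordMap (φ : R →+* S) (g : (ι →₀ R) →ₗ[R] (ι →₀ R)) (x : ι →₀ R) :
    mapEnd φ g (coordMap φ x) = coordMap φ (g x) := by
  induction x using Finsupp.induction_linear with
  | zero => simp
  | add x y hx hy => simp [hx, hy]
  | single i a =>
    have h : Finsupp.single i a = a • Finsupp.single i (1 : R) := by simp
    rw [coordMap_single, mapEnd, Finsupp.linearCombination_single, h, map_smul, coordMap_smul]

lemma ext_coordMap (φ : R →+* S) {M : Type*} [AddCommGroup M] [Module S M]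
    {f g : (ι →₀ S) →ₗ[S] M} (h : ∀ x, f (coordMap φ x) = g (coordMap φ x)) : f = g := by
  apply Finsupp.lhom_ext'
  intro i
  ext
  simpa [coordMap_single] using h (Finsupp.single i 1)

lemma baseChange_map (φ : R →+* S) (g : (ι →₀ R) →ₗ[R] (ι →₀ R)) (N : Submodule R (ι →₀ R)) :
    baseChange φ (N.map g) = (baseChange φ N).map (mapEnd φ g) := by
  rw [baseChange, baseChange, Submodule.map_span, Submodule.map_coe, Set.image_image,
    Set.image_image]
  simp [mapEnd_coordMap]

/-- The base change of a linear automorphism of `R^{⊕ι}`. -/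
def mapGL (φ : R →+* S) (g : (ι →₀ R) ≃ₗ[R] (ι →₀ R)) :
    (ι →₀ S) ≃ₗ[S] (ι →₀ S) :=
  LinearEquiv.ofLinearMap (mapEnd φ g) (mapEnd φ g.symm)
    (ext_coordMap φ fun x => by simp [mapEnd_coordMap])
    (ext_coordMap φ fun x => by simp [mapEnd_coordMap])

lemma baseChange_isCompl (φ : R →+* S) {N N' : Submodule R (ι →₀ R)} (h : IsCompl N N') :
    IsCompl (baseChange φ N) (baseChange φ N') := by
  constructor
  · rw [Submodule.disjoint_def]
    intro x hx hx'
    let p : (ι →₀ R) →ₗ[R] (ι →₀ R) := N.subtype ∘ₗ N.projectionOnto N' h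
    have h1 : baseChange φ N ≤ LinearMap.eqLocus (mapEnd φ p) LinearMap.id := by
      rw [baseChange_le]
      intro y hy
      have : p y = y := by
        simp [p, Submodule.projectionOnto_apply_left h ⟨y, hy⟩]
      simp [mapEnd_coordMap, this]
    have h2 : baseChange φ N' ≤ LinearMap.ker (mapEnd φ p) := by
      rw [baseChange_le]
      intro y hy
      have : p y = 0 := by
        simp [p, Submodule.projectionOnto_apply_right h ⟨y, hy⟩]
      simp [mapEnd_coordMap, this]
    have e1 := h1 hx
    have e2 := h2 hx'
    simp only [LinearMap.mem_eqLocus, LinearMap.id_coe, id_eq] at e1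
    rw [LinearMap.mem_ker] at e2
    rw [← e1, e2]
  · rw [codisjoint_iff, eq_top_iff, ← baseChange_top φ, baseChange_le]
    intro x _
    have hx : x ∈ N ⊔ N' := by rw [h.sup_eq_top]; trivial
    obtain ⟨y, hy, z, hz, rfl⟩ := Submodule.mem_sup.1 hx
    rw [map_add]
    exact Submodule.add_mem_sup (coordMap_mem φ hy) (coordMap_mem φ hz)

lemma nonempty_equiv_of_semilinear [Algebra R S] {Q Q' : Type*} [AddCommGroup Q] [Module R Q]
    [AddCommGroup Q'] [Module S Q'] (f : Q →+ Q') (hf : ∀ (a : R) q, f (a • q) = algebraMap R S a • f q)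
    (hspan : Submodule.span S (Set.range f) = ⊤) (g : Q' →ₗ[S] S ⊗[R] Q)
    (hg : ∀ q, g (f q) = 1 ⊗ₜ q) : Nonempty ((S ⊗[R] Q) ≃ₗ[S] Q') := by
  let : Module R Q' := Module.compHom Q' (algebraMap R S)
  have : IsScalarTower R S Q' := IsScalarTower.of_algebraMap_smul fun _ _ => rfl
  let f' : Q →ₗ[R] Q' := { f with map_smul' := fun a q => hf a q }
  have hf' : ∀ q, f' q = f q := fun _ => rfl
  refine ⟨LinearEquiv.ofLinearMap (f'.liftBaseChange S) g ?_ ?_⟩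
  · apply LinearMap.ext_on_range hspan
    intro q
    simp [hg, hf']
  · apply TensorProduct.AlgebraTensorModule.ext
    intro s q
    simp only [LinearMap.comp_apply, LinearMap.liftBaseChange_tmul, hf', map_smul, hg,
      LinearMap.id_apply, TensorProduct.smul_tmul', smul_eq_mul, mul_one]

lemma nonempty_quotientEquiv_aux [Algebra R S] {M M' : Type*} [AddCommGroup M] [Module R M]
    [AddCommGroup M'] [Module S M'] (c : M →+ M')
    (hc : ∀ (a : R) x, c (a • x) = algebraMap R S a • c x)
    {L N C : Submodule R M} (hLN : L ≤ N) (hC : IsCompl N C) {L' N' : Submodule S M'}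
    (hL : L' = Submodule.span S (c '' L)) (hN : N' = Submodule.span S (c '' N))
    (hG : ∀ q : M →ₗ[R] SubQuot N L, ∃ G : M' →ₗ[S] S ⊗[R] SubQuot N L, ∀ x, G (c x) = 1 ⊗ₜ q x) :
    Nonempty ((S ⊗[R] (SubQuot N L)) ≃ₗ[S] (SubQuot N' L')) := by
  have mL : ∀ x ∈ L, c x ∈ L' := fun x hx => hL ▸ Submodule.subset_span ⟨x, hx, rfl⟩
  have mN : ∀ x ∈ N, c x ∈ N' := fun x hx => hN ▸ Submodule.subset_span ⟨x, hx, rfl⟩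
  let c0 : N →+ N' :=
    { toFun := fun x => ⟨c x.1, mN x.1 x.2⟩
      map_zero' := Subtype.ext (by simp)
      map_add' := fun x y => Subtype.ext (by simp) }
  let h0 : N →+ SubQuot N' L' := (L'.submoduleOf N').mkQ.toAddMonoidHom.comp c0
  have h0k : (L.submoduleOf N).toAddSubgroup ≤ h0.ker := by
    intro x hx
    have hx : x.1 ∈ L := hx
    exact (Submodule.Quotient.mk_eq_zero (L'.submoduleOf N')).2 (mL x.1 hx)
  let f : SubQuot N L →+ SubQuot N' L' := QuotientAddGroup.lift _ h0 h0k
  have f_mk : ∀ x : N, f (Submodule.Quotient.mk x) = Submodule.Quotient.mk (c0 x) := fun _ => rfl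
  let q : M →ₗ[R] SubQuot N L := (L.submoduleOf N).mkQ ∘ₗ N.projectionOnto C hC
  have hq : ∀ x : N, q x = Submodule.Quotient.mk x := by
    intro x
    simp only [q, LinearMap.comp_apply, Submodule.projectionOnto_apply_left, Submodule.mkQ_apply]
  obtain ⟨G, hG⟩ := hG q
  let g0 : N' →ₗ[S] S ⊗[R] SubQuot N L := G ∘ₗ N'.subtype
  have hg0 : L'.submoduleOf N' ≤ LinearMap.ker g0 := by
    have : L' ≤ LinearMap.ker G := by
      rw [hL, Submodule.span_le]
      rintro _ ⟨x, hx, rfl⟩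
      have : q x = 0 := by
        rw [hq ⟨x, hLN hx⟩]
        exact (Submodule.Quotient.mk_eq_zero _).2 hx
      change G (c x) = 0
      rw [hG, this, TensorProduct.tmul_zero]
    intro x hx
    exact this hx
  refine nonempty_equiv_of_semilinear f ?_ ?_ (Submodule.liftQ _ g0 hg0) ?_
  · intro a x
    obtain ⟨x, rfl⟩ := Submodule.Quotient.mk_surjective _ x
    rw [← Submodule.Quotient.mk_smul, f_mk, f_mk, ← Submodule.Quotient.mk_smul]
    congr 1
    exact Subtype.ext (hc a x.1)
  · rw [eq_top_iff]
    rintro y -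
    obtain ⟨⟨y, hy⟩, rfl⟩ := Submodule.Quotient.mk_surjective _ y
    subst hN
    induction hy using Submodule.span_induction with
    | mem y h =>
      obtain ⟨x, hx, rfl⟩ := h
      exact Submodule.subset_span ⟨Submodule.Quotient.mk ⟨x, hx⟩, rfl⟩
    | zero => exact Submodule.zero_mem _
    | add y z _ _ hy hz => exact Submodule.add_mem _ hy hz
    | smul a y _ hy => exact Submodule.smul_mem _ a hy
  · intro x
    obtain ⟨x, rfl⟩ := Submodule.Quotient.mk_surjective _ x
    rw [f_mk, ← hq]
    exact hG x

/-- Base change commutes with the successive quotients of nested direct summands. -/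
lemma exists_quotientEquiv [Algebra R S] {L N C : Submodule R (ι →₀ R)} (hLN : L ≤ N)
    (hC : IsCompl N C) :
    Nonempty ((S ⊗[R] (SubQuot N L)) ≃ₗ[S]
      (SubQuot (baseChange (algebraMap R S) N) (baseChange (algebraMap R S) L))) := by
  refine nonempty_quotientEquiv_aux (coordMap (algebraMap R S)) (coordMap_smul _) hLN hC rfl rfl ?_
  intro q
  refine ⟨Finsupp.linearCombination S fun i => 1 ⊗ₜ q (Finsupp.single i 1), fun x => ?_⟩
  induction x using Finsupp.induction_linear with
  | zero => simp
  | add x y hx hy => simp only [map_add, hx, hy, TensorProduct.tmul_add]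
  | single i a =>
    have h : Finsupp.single i a = a • Finsupp.single i (1 : R) := by simp
    rw [coordMap_single, Finsupp.linearCombination_single, h, map_smul,
      TensorProduct.tmul_smul, ← algebraMap_smul S a]

/-- Base change of flags. -/
lemma IsFlag.baseChange {I : Type*} [LinearOrder I] (φ : R →+* S)
    {F : I → Submodule R (ι →₀ R)} (hF : IsFlag F) :
    IsFlag fun i => FlagSpace.baseChange φ (F i) := by
  let := φ.toAlgebra
  have e : ∀ i j, i ⋖ j → Nonempty ((S ⊗[R] (SubQuot (F j) (F i))) ≃ₗ[S]
      (SubQuot (FlagSpace.baseChange φ (F j)) (FlagSpace.baseChange φ (F i)))) := by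
    intro i j hij
    obtain ⟨C, hC⟩ := hF.summand j
    exact exists_quotientEquiv (hF.mono hij.le) hC
  constructor
  · obtain ⟨i, hi⟩ := hF.exists_bot
    exact ⟨i, by rw [hi, baseChange_bot]⟩
  · obtain ⟨i, hi⟩ := hF.exists_top
    exact ⟨i, by rw [hi, baseChange_top]⟩
  · exact fun i j hij => baseChange_mono φ (hF.mono hij)
  · intro i
    obtain ⟨C, hC⟩ := hF.summand i
    exact ⟨_, baseChange_isCompl φ hC⟩
  · intro i j hij
    obtain ⟨e⟩ := e i j hij
    have := hF.finite i j hij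
    exact Module.Finite.equiv e
  · intro i j hij
    obtain ⟨e⟩ := e i j hij
    have := hF.projective i j hij
    exact Module.Projective.of_equiv e
  · intro i j hij p
    obtain ⟨e⟩ := e i j hij
    have := hF.finite i j hij
    have := hF.projective i j hij
    rw [← Module.rankAtStalk_eq_of_equiv e, Module.rankAtStalk_baseChange]
    exact hF.rank_one i j hij _
  · intro i hi
    rw [← hF.limit i hi]
    simp only [baseChange_iSup]

end BaseChange

section KFunctors

variable (k : Type u) [CommRing k]

/-- The flag functor `Fl_I`: it sends a `k`-algebra `R` to the set of `I`-flags in `R^{⊕ I_s}`,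
and acts on morphisms by base change. -/
def Fl (I : Type w) [LinearOrder I] : CommAlgCat.{v} k ⥤ Type (max v w) where
  obj R := {F : I → Submodule R (Succs I →₀ R) // IsFlag F}
  map φ := TypeCat.ofHom fun F => ⟨fun i => baseChange φ.hom.toRingHom (F.1 i), F.2.baseChange _⟩
  map_id R := by
    refine ConcreteCategory.hom_ext _ _ fun F => ?_
    exact Subtype.ext (funext fun i => baseChange_id (F.1 i))
  map_comp φ ψ := by
    refine ConcreteCategory.hom_ext _ _ fun F => ?_
    exact Subtype.ext (funext fun i => baseChange_comp φ.hom.toRingHom ψ.hom.toRingHom (F.1 i))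

variable {k}

/-- The fppf hull `sh Y` of a subfunctor `Y` of a `k`-functor `X`: an element of `X R` belongs to
`(sh Y) R` iff its image in `X S` belongs to `Y S` for some fppf (faithfully flat and finitely
presented) `R`-algebra `S`. -/
def fppfHull {X : CommAlgCat.{v} k ⥤ Type w} (Y : Subfunctor X) : Subfunctor X where
  obj R := {x | ∃ (S : CommAlgCat.{v} k) (φ : R ⟶ S), φ.hom.toRingHom.FaithfullyFlat ∧
    φ.hom.toRingHom.FinitePresentation ∧ X.map φ x ∈ Y.obj S}
  map := by
    rintro R R' ψ x ⟨S, φ, hflat, hfp, hx⟩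
    let : Algebra R S := φ.hom.toRingHom.toAlgebra
    let : Algebra R R' := ψ.hom.toRingHom.toAlgebra
    have : IsScalarTower k R S := IsScalarTower.of_algebraMap_eq fun a => (φ.hom.commutes a).symm
    have : IsScalarTower k R R' := IsScalarTower.of_algebraMap_eq fun a => (ψ.hom.commutes a).symm
    have : Module.FaithfullyFlat R S := hflat
    have : Algebra.FinitePresentation R S := hfp
    let T : CommAlgCat.{v} k := CommAlgCat.of k (R' ⊗[R] S)
    let α : R' ⟶ T := CommAlgCat.ofHom
      ((Algebra.TensorProduct.includeLeft : R' →ₐ[R] R' ⊗[R] S).restrictScalars k)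
    let β : S ⟶ T := CommAlgCat.ofHom
      ((Algebra.TensorProduct.includeRight : S →ₐ[R] R' ⊗[R] S).restrictScalars k)
    have hcomm : ψ ≫ α = φ ≫ β := by
      ext a
      exact ((Algebra.TensorProduct.includeLeft : R' →ₐ[R] R' ⊗[R] S).commutes a).trans
        ((Algebra.TensorProduct.includeRight : S →ₐ[R] R' ⊗[R] S).commutes a).symm
    refine ⟨T, α, ?_, ?_, ?_⟩
    · exact (RingHom.faithfullyFlat_algebraMap_iff (R := R') (S := R' ⊗[R] S)).2 inferInstance
    · exact (RingHom.finitePresentation_algebraMap (A := R') (B := R' ⊗[R] S)).2 inferInstance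
    · have : X.map α (X.map ψ x) = X.map β (X.map φ x) := by
        rw [← Functor.map_comp_apply, hcomm, Functor.map_comp_apply]
      rw [this]
      exact Y.map β hx

/-- Subfunctors `Y`, `Z` of a `k`-functor are disjoint if `Y R` and `Z R` are disjoint for every
nonzero `k`-algebra `R`. -/
def SubfunctorsDisjoint {X : CommAlgCat.{v} k ⥤ Type w} (Y Z : Subfunctor X) : Prop :=
  ∀ R : CommAlgCat.{v} k, Nontrivial R → Disjoint (Y.obj R) (Z.obj R)

/-- A family of subfunctors covers a `k`-functor `X` if `X R` is the union of the values at `R`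
for every `k`-algebra `R` which is a field. -/
def SubfunctorsCover {X : CommAlgCat.{v} k ⥤ Type w} {A : Type*} (Y : A → Subfunctor X) : Prop :=
  ∀ R : CommAlgCat.{v} k, IsField R → ⋃ a, (Y a).obj R = Set.univ

end KFunctors

section Schubert

variable {R S : Type v} [CommRing R] [CommRing S]

/-- The group `GL_ι(R)` of invertible column-finite `ι × ι` matrices over `R`, as the group of
automorphisms of `R^{⊕ι}`; the entry of `g` at `(i, j)` is `g e_j i`. -/
abbrev GLGroup (ι : Type w) (R : Type v) [CommRing R] : Type (max v w) := (ι →₀ R) ≃ₗ[R] (ι →₀ R)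

/-- The group `B(R)` of invertible upper triangular matrices: the entries at `(i, j)` with `i > j`
vanish. -/
def Borel (ι : Type w) [LinearOrder ι] (R : Type v) [CommRing R] : Set (GLGroup ι R) :=
  {g | ∀ i j : ι, j < i → g (Finsupp.single j 1) i = 0}

/-- The permutation matrix of `σ`, sending `e_j` to `e_{σ j}`. -/
def permMatrix {ι : Type w} (σ : Equiv.Perm ι) : GLGroup ι R := Finsupp.domLCongr σ

/-- The standard filtration `E` of `R^{⊕ I_s}`: `E_i` is the span of the `e_j` with `j ≤ i`. -/
def stdFlag (I : Type w) [LinearOrder I] (R : Type v) [CommRing R] (i : I) :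
    Submodule R (Succs I →₀ R) :=
  Submodule.span R ((fun j : Succs I => Finsupp.single j 1) '' {j | j.1 ≤ i})

lemma baseChange_stdFlag {I : Type w} [LinearOrder I] (φ : R →+* S) (i : I) :
    baseChange φ (stdFlag I R i) = stdFlag I S i := by
  rw [stdFlag, baseChange_span, Set.image_image]
  simp [coordMap_single, stdFlag]

lemma mapGL_apply_single {ι : Type w} (φ : R →+* S) (g : GLGroup ι R) (j : ι) :
    mapGL φ g (Finsupp.single j 1) = coordMap φ (g (Finsupp.single j 1)) := by
  have h := mapEnd_coordMap φ g.toLinearMap (Finsupp.single j 1)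
  rw [coordMap_single, map_one] at h
  exact h

lemma mapGL_mem_Borel {ι : Type w} [LinearOrder ι] (φ : R →+* S) {g : GLGroup ι R}
    (hg : g ∈ Borel ι R) : mapGL φ g ∈ Borel ι S := by
  intro i j hij
  rw [mapGL_apply_single]
  simp [coordMap, hg i j hij]

lemma mapEnd_permMatrix {ι : Type w} (φ : R →+* S) (σ : Equiv.Perm ι) :
    mapEnd φ (permMatrix (R := R) σ).toLinearMap = (permMatrix (R := S) σ).toLinearMap := by
  apply Finsupp.lhom_ext'
  intro i
  ext
  simp [mapEnd, permMatrix, coordMap_single]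

variable {k : Type u} [CommRing k]

/-- The orbit `BσE`: it sends a `k`-algebra `R` to the set of flags `bσE` with `b ∈ B(R)`. -/
def borelOrbit {I : Type w} [LinearOrder I] (σ : Equiv.Perm (Succs I)) :
    Subfunctor (Fl.{u, v, w} k I) where
  obj R := {F | ∃ b ∈ Borel (Succs I) R, F.1 = fun i =>
    ((stdFlag I R i).map (permMatrix (R := R) σ).toLinearMap).map b.toLinearMap}
  map := by
    rintro R S φ F ⟨b, hb, hF⟩
    refine ⟨mapGL φ.hom.toRingHom b, mapGL_mem_Borel _ hb, ?_⟩
    funext i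
    change baseChange φ.hom.toRingHom (F.1 i) = _
    rw [hF, baseChange_map, baseChange_map, baseChange_stdFlag, mapEnd_permMatrix]
    rfl

/-- The Schubert cell `X°_σ = sh(BσE)`. -/
def schubertCell {I : Type w} [LinearOrder I] (σ : Equiv.Perm (Succs I)) :
    Subfunctor (Fl.{u, v, w} k I) :=
  fppfHull (borelOrbit σ)

end Schubert

end

end FlagSpace

/-! Over a field `K`, let the lead of a nonzero vector be the position of its last nonzero
coordinate, and attach to a subspace the set of leads of its vectors. Since the index set is
well-ordered, Gaussian elimination terminates: nested subspaces with the same leads are equal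
(`le_of_leads_subset`), and a one-dimensional step adds exactly one lead
(`existsUnique_lead_of_finrank_eq_one`).

For a flag `F`, the new lead at each successor defines a map `Succs I → Succs I`, which is a
bijection `σ`: leads that are already present are not new, and every lead of the whole module enters
at some successor, because nothing new appears at a limit. Vectors realizing the new leads are the
columns of an upper triangular `b` with `F = bσE` (`IsFlag.exists_eq_map_stdFlag`). This gives the
covering.

Conversely, an invertible upper triangular matrix preserves leads (`hasLead_of_mem_Borel`,
`leads_map`), so the leads of `bσE` at `i` are `σ {j ≤ i}`, and these sets recover `σ`. Disjointness
over a nonzero ring reduces to this case: two fppf covers have a nonzero common refinement, which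
maps to a field. -/

namespace FlagSpace

/-! ### Leads of vectors and subspaces -/

section LeadingPositions

variable {ι : Type w} [LinearOrder ι]

/-- The nonzero vector `x` has its last nonzero coordinate at the position `m`. -/
def HasLead {R : Type v} [CommRing R] (x : ι →₀ R) (m : ι) : Prop :=
  x m ≠ 0 ∧ ∀ n, m < n → x n = 0

/-- The set of positions of the last nonzero coordinates of the vectors of `N`. -/
def leads {R : Type v} [CommRing R] (N : Submodule R (ι →₀ R)) : Set ι :=
  {m | ∃ x ∈ N, HasLead x m}

lemma exists_hasLead {R : Type v} [CommRing R] {x : ι →₀ R} (hx : x ≠ 0) :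
    ∃ m, HasLead x m := by
  have hs : x.support.Nonempty := Finsupp.support_nonempty_iff.2 hx
  refine ⟨x.support.max' hs, Finsupp.mem_support_iff.1 (x.support.max'_mem hs), fun n hn => ?_⟩
  by_contra h
  exact absurd (x.support.le_max' n (Finsupp.mem_support_iff.2 h)) (not_le.2 hn)

lemma HasLead.ne_zero {R : Type v} [CommRing R] {x : ι →₀ R} {m : ι} (h : HasLead x m) :
    x ≠ 0 := by
  rintro rfl
  exact h.1 rfl

lemma HasLead.unique {R : Type v} [CommRing R] {x : ι →₀ R} {m n : ι} (hm : HasLead x m)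
    (hn : HasLead x n) : m = n := by
  rcases lt_trichotomy m n with h | h | h
  · exact absurd (hm.2 n h) hn.1
  · exact h
  · exact absurd (hn.2 m h) hm.1

lemma leads_mono {R : Type v} [CommRing R] {L N : Submodule R (ι →₀ R)} (h : L ≤ N) :
    leads L ⊆ leads N := fun _ ⟨x, hx, hm⟩ => ⟨x, h hx, hm⟩

variable {K : Type v} [Field K]

lemma HasLead.smul {x : ι →₀ K} {m : ι} (h : HasLead x m) {c : K} (hc : c ≠ 0) :
    HasLead (c • x) m :=
  ⟨by simpa using ⟨hc, h.1⟩, fun n hn => by simp [h.2 n hn]⟩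

lemma HasLead.add {x y : ι →₀ K} {m n : ι} (hx : HasLead x m) (hy : HasLead y n) (h : m < n) :
    HasLead (x + y) n :=
  ⟨by simpa [hx.2 n h] using hy.1, fun l hl => by simp [hx.2 l (h.trans hl), hy.2 l hl]⟩

/-- Gaussian elimination: subtracting from a vector of `N` a multiple of a vector of `L` with the
same lead strictly lowers the lead, so well-founded induction on the lead applies. -/
lemma le_of_leads_subset [WellFoundedLT ι] {L N : Submodule K (ι →₀ K)} (hLN : L ≤ N)
    (h : leads N ⊆ leads L) : N ≤ L := by
  have key : ∀ m, ∀ x ∈ N, HasLead x m → x ∈ L := by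
    intro m
    induction m using WellFoundedLT.induction with
    | ind m ih =>
      intro x hx hm
      obtain ⟨y, hy, hym⟩ := h ⟨x, hx, hm⟩
      have hz : x - (x m / y m) • y ∈ L := by
        by_cases h0 : x - (x m / y m) • y = 0
        · rw [h0]; exact zero_mem _
        obtain ⟨n, hn⟩ := exists_hasLead h0
        refine ih n ?_ _ (sub_mem hx (N.smul_mem _ (hLN hy))) hn
        by_contra! hmn
        apply hn.1
        rcases hmn.eq_or_lt with rfl | hmn
        · simp [div_mul_cancel₀ _ hym.1]
        · simp [hm.2 n hmn, hym.2 n hmn]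
      simpa using add_mem hz (L.smul_mem (x m / y m) hy)
  intro x hx
  by_cases h0 : x = 0
  · rw [h0]; exact zero_mem _
  obtain ⟨m, hm⟩ := exists_hasLead h0
  exact key m x hx hm

lemma existsUnique_lead_of_finrank_eq_one [WellFoundedLT ι] {L N : Submodule K (ι →₀ K)}
    (hLN : L ≤ N) (h : Module.finrank K (SubQuot N L) = 1) : ∃! m, m ∈ leads N \ leads L := by
  have hex : (leads N \ leads L).Nonempty := by
    rw [Set.sdiff_nonempty]
    intro hs
    have hNL := le_of_leads_subset hLN hs
    have : Subsingleton (SubQuot N L) :=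
      Submodule.Quotient.subsingleton_iff.2 (Submodule.submoduleOf_eq_top.2 hNL)
    rw [Module.finrank_zero_of_subsingleton] at h
    exact zero_ne_one h
  obtain ⟨v, hv0, hv⟩ := finrank_eq_one_iff'.1 h
  -- With the classes of `x` and `y` equal to `a • v` and `b • v`, the vector `a • y - b • x` lies
  -- in `L`. As `a ≠ 0` and `m < n`, it still has lead `n`, although `n` is not a lead of `L`.
  have key : ∀ m ∈ leads N \ leads L, ∀ n ∈ leads N \ leads L, ¬ m < n := by
    rintro m ⟨⟨x, hx, hm⟩, hmL⟩ n ⟨⟨y, hy, hn⟩, hnL⟩ hmn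
    obtain ⟨a, ha⟩ := hv (Submodule.Quotient.mk ⟨x, hx⟩)
    obtain ⟨b, hb⟩ := hv (Submodule.Quotient.mk ⟨y, hy⟩)
    have ha0 : a ≠ 0 := by
      rintro rfl
      rw [zero_smul, eq_comm, Submodule.Quotient.mk_eq_zero] at ha
      exact hmL ⟨x, ha, hm⟩
    have hmem : (-b) • x + a • y ∈ L := by
      have : (Submodule.Quotient.mk ((-b) • ⟨x, hx⟩ + a • ⟨y, hy⟩ : N) : SubQuot N L) = 0 := by
        rw [Submodule.Quotient.mk_add, Submodule.Quotient.mk_smul, Submodule.Quotient.mk_smul,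
          ← ha, ← hb, smul_smul, smul_smul, ← add_smul]
        simp [mul_comm]
      rw [Submodule.Quotient.mk_eq_zero] at this
      exact this
    refine hnL ⟨_, hmem, ?_⟩
    by_cases hb0 : b = 0
    · simpa [hb0] using hn.smul ha0
    · exact (hm.smul (neg_ne_zero.2 hb0)).add (hn.smul ha0) hmn
  obtain ⟨m, hm⟩ := hex
  exact ⟨m, hm, fun n hn => le_antisymm (not_lt.1 (key m hm n hn)) (not_lt.1 (key n hn m hm))⟩

end LeadingPositions

/-! ### Upper triangular matrices and leads -/

section Triangular

variable {ι : Type w} [LinearOrder ι] {K : Type v} [Field K]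

/-- An endomorphism which preserves the leading positions of the basis vectors preserves all
leading positions. -/
lemma HasLead.map {f : (ι →₀ K) →ₗ[K] (ι →₀ K)}
    (hf : ∀ j, HasLead (f (Finsupp.single j 1)) j) {x : ι →₀ K} {m : ι} (h : HasLead x m) :
    HasLead (f x) m := by
  have e : ∀ n, f x n = x.sum fun j a => a * f (Finsupp.single j 1) n := by
    intro n
    conv_lhs => rw [← Finsupp.sum_single x]
    rw [map_finsuppSum, Finsupp.sum_apply]
    refine Finsupp.sum_congr fun j _ => ?_
    rw [← Finsupp.smul_single_one, map_smul, Finsupp.smul_apply, smul_eq_mul]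
  have hs : ∀ j ∈ x.support, j ≤ m := by
    intro j hj
    by_contra! hlt
    exact Finsupp.mem_support_iff.1 hj (h.2 j hlt)
  constructor
  · rw [e, Finsupp.sum, Finset.sum_eq_single m]
    · exact mul_ne_zero h.1 (hf m).1
    · intro j hj hjm
      rw [(hf j).2 m (lt_of_le_of_ne (hs j hj) hjm), mul_zero]
    · intro hm
      exact absurd (Finsupp.mem_support_iff.2 h.1) hm
  · intro n hn
    rw [e]
    refine Finset.sum_eq_zero fun j hj => ?_
    change x j * _ = 0
    rw [(hf j).2 n ((hs j hj).trans_lt hn), mul_zero]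

lemma leads_map {f : (ι →₀ K) →ₗ[K] (ι →₀ K)} (hf : ∀ j, HasLead (f (Finsupp.single j 1)) j)
    (N : Submodule K (ι →₀ K)) : leads (N.map f) = leads N := by
  ext m
  constructor
  · rintro ⟨_, ⟨x, hx, rfl⟩, hm⟩
    have hx0 : x ≠ 0 := by
      rintro rfl
      exact hm.ne_zero (map_zero f)
    obtain ⟨n, hn⟩ := exists_hasLead hx0
    exact (hn.map hf).unique hm ▸ ⟨x, hx, hn⟩
  · rintro ⟨x, hx, hm⟩
    exact ⟨f x, ⟨x, hx, rfl⟩, hm.map hf⟩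

/-- Injectivity holds because a vector with a lead has an image with a lead; surjectivity because
the range has the same leads as the whole space. -/
lemma bijective_of_hasLead [WellFoundedLT ι] {f : (ι →₀ K) →ₗ[K] (ι →₀ K)}
    (hf : ∀ j, HasLead (f (Finsupp.single j 1)) j) : Function.Bijective f := by
  constructor
  · rw [injective_iff_map_eq_zero]
    intro x hx
    by_contra h0
    obtain ⟨m, hm⟩ := exists_hasLead h0
    exact (hm.map hf).ne_zero hx
  · rw [← LinearMap.range_eq_top, ← Submodule.map_top, eq_top_iff]
    exact le_of_leads_subset le_top (leads_map hf ⊤).ge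

/-- The diagonal entries of an invertible upper triangular matrix do not vanish. -/
lemma hasLead_of_mem_Borel [WellFoundedLT ι] {b : GLGroup ι K} (hb : b ∈ Borel ι K) (j : ι) :
    HasLead (b (Finsupp.single j 1)) j := by
  -- `Borel` does not ask the inverse to be upper triangular, and over `ℤ` the shift `e_j ↦ e_{j-1}`
  -- has zero diagonal. The induction therefore also carries a preimage of `e_j` supported on
  -- positions `≤ j`.
  suffices h : ∀ j, b (Finsupp.single j 1) j ≠ 0 ∧
      ∃ x : ι →₀ K, (∀ n, j < n → x n = 0) ∧ b x = Finsupp.single j 1 from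
    ⟨(h j).1, fun n hn => hb n j hn⟩
  clear j
  intro j
  induction j using WellFoundedLT.induction with
  | ind j ih =>
    set y := b (Finsupp.single j 1) with hy
    have key : ∀ s : Finset ι, (∀ i ∈ s, i < j) → ∀ c : ι → K, ∃ z : ι →₀ K,
        (∀ n, j ≤ n → z n = 0) ∧ b z = ∑ i ∈ s, Finsupp.single i (c i) := by
      intro s hs c
      choose! x hx hbx using fun i hi => (ih i hi).2
      refine ⟨∑ i ∈ s, c i • x i, fun n hn => ?_, ?_⟩
      · rw [Finsupp.finsetSum_apply]
        refine Finset.sum_eq_zero fun i hi => ?_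
        rw [Finsupp.smul_apply, hx i (hs i hi) n ((hs i hi).trans_le hn), smul_zero]
      · rw [map_sum]
        refine Finset.sum_congr rfl fun i hi => ?_
        rw [map_smul, hbx i (hs i hi), Finsupp.smul_single_one]
    -- `z` is supported strictly below `j`, and `b z` is the part of the column `y` above the
    -- diagonal.
    obtain ⟨z, hz, hbz⟩ := key (y.support.erase j) (fun i hi => by
      rw [Finset.mem_erase, Finsupp.mem_support_iff] at hi
      exact lt_of_le_of_ne (le_of_not_gt fun h => hi.2 (hb i j h)) hi.1) y
    have e : b (Finsupp.single j 1 - z) = Finsupp.single j (y j) := by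
      rw [map_sub, hbz, ← hy, sub_eq_iff_eq_add']
      conv_lhs => rw [← Finsupp.sum_single y]
      rw [Finsupp.sum]
      by_cases hj : j ∈ y.support
      · rw [Finset.sum_erase_add _ _ hj]
      · rw [Finset.erase_eq_of_notMem hj, Finsupp.notMem_support_iff.1 hj, Finsupp.single_zero,
          add_zero]
    -- Otherwise `b` kills `e_j - z`, whose coordinate at `j` is `1`.
    have h0 : y j ≠ 0 := by
      intro h0
      rw [h0, Finsupp.single_zero, map_eq_zero_iff b b.injective] at e
      simpa [hz j le_rfl] using DFunLike.congr_fun e j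
    refine ⟨h0, (y j)⁻¹ • (Finsupp.single j 1 - z), fun n hn => ?_, ?_⟩
    · simp [hz n hn.le, Finsupp.single_eq_of_ne hn.ne']
    · rw [map_smul, e, Finsupp.smul_single, smul_eq_mul, inv_mul_cancel₀ h0]

end Triangular

/-! ### The Bruhat decomposition over a field -/

section Bruhat

variable {I : Type w} [LinearOrder I] {K : Type v} [Field K]

lemma map_permMatrix_stdFlag (σ : Equiv.Perm (Succs I)) (i : I) :
    (stdFlag I K i).map (permMatrix (R := K) σ).toLinearMap =
      Submodule.span K ((fun j : Succs I => Finsupp.single (σ j) 1) '' {j | j.1 ≤ i}) := by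
  rw [stdFlag, Submodule.map_span, Set.image_image]
  simp [permMatrix]

lemma leads_map_permMatrix_stdFlag (σ : Equiv.Perm (Succs I)) (i : I) :
    leads ((stdFlag I K i).map (permMatrix (R := K) σ).toLinearMap) = σ '' {j | j.1 ≤ i} := by
  rw [map_permMatrix_stdFlag]
  apply subset_antisymm
  · rintro m ⟨x, hx, hm⟩
    rw [← Set.image_image (fun j => Finsupp.single j (1 : K)) σ,
      ← Finsupp.supported_eq_span_single, Finsupp.mem_supported] at hx
    exact hx (Finsupp.mem_support_iff.2 hm.1)
  · rintro _ ⟨j, hj, rfl⟩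
    exact ⟨_, Submodule.subset_span ⟨j, hj, rfl⟩, by simp,
      fun n hn => Finsupp.single_eq_of_ne hn.ne'⟩

/-- A flag over a field determines the permutation of its Schubert cell. -/
lemma perm_eq_of_map_stdFlag_eq [WellFoundedLT I] {σ τ : Equiv.Perm (Succs I)}
    {b c : GLGroup (Succs I) K} (hb : b ∈ Borel (Succs I) K) (hc : c ∈ Borel (Succs I) K)
    (h : ∀ i, ((stdFlag I K i).map (permMatrix (R := K) σ).toLinearMap).map b.toLinearMap =
      ((stdFlag I K i).map (permMatrix (R := K) τ).toLinearMap).map c.toLinearMap) : σ = τ := by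
  have e : ∀ i : I, σ '' {j | j.1 ≤ i} = τ '' {j | j.1 ≤ i} := by
    intro i
    have := congrArg leads (h i)
    rwa [leads_map (hasLead_of_mem_Borel hb), leads_map (hasLead_of_mem_Borel hc),
      leads_map_permMatrix_stdFlag, leads_map_permMatrix_stdFlag] at this
  ext1 j
  obtain ⟨p, hp⟩ := j.2
  obtain ⟨j', hj', hj⟩ : σ j ∈ τ '' {l | l.1 ≤ j.1} := e j.1 ▸ ⟨j, le_refl j.1, rfl⟩
  -- If `j' < j`, then `j' ≤ p`, so equality of the two images at the predecessor `p` puts `σ j`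
  -- into `σ {l ≤ p}`, which contradicts injectivity of `σ`.
  rcases lt_or_eq_of_le (show j'.1 ≤ j.1 from hj') with hlt | heq
  · obtain ⟨l, hl, hlj⟩ : σ j ∈ σ '' {l | l.1 ≤ p} :=
      (e p).symm ▸ ⟨j', hp.le_of_lt hlt, hj⟩
    rw [σ.injective hlj] at hl
    exact absurd hp.lt (not_lt.2 hl)
  · rw [← hj, Subtype.ext heq]

lemma IsFlag.finrank_eq_one {F : I → Submodule K (Succs I →₀ K)} (hF : IsFlag F) {i j : I}
    (hij : i ⋖ j) : Module.finrank K (SubQuot (F j) (F i)) = 1 := by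
  have h := hF.rank_one i j hij ⊥
  have := hF.finite i j hij
  rwa [Module.rankAtStalk_eq_finrank_of_free] at h

/-- A union of a chain of subspaces has no vectors beyond those of its members. At the least element
of `I` the union is empty and `F i` is zero. -/
lemma IsFlag.exists_mem_leads_of_limit {F : I → Submodule K (Succs I →₀ K)} (hF : IsFlag F)
    {i : I} (hi : ¬ ∃ j, j ⋖ i) {m : Succs I} (hm : m ∈ leads (F i)) :
    ∃ j < i, m ∈ leads (F j) := by
  obtain ⟨x, hx, hxm⟩ := hm
  rw [← hF.limit i hi, iSup_subtype'] at hx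
  cases isEmpty_or_nonempty {j // j < i}
  · rw [iSup_of_empty, Submodule.mem_bot] at hx
    exact absurd hx hxm.ne_zero
  · have hdir : Directed (· ≤ ·) fun j : {j // j < i} => F j :=
      Monotone.directed_le fun a b hab => hF.mono hab
    rw [Submodule.mem_iSup_of_directed _ hdir] at hx
    obtain ⟨j, hj⟩ := hx
    exact ⟨j.1, j.2, x, hj, hxm⟩

/-- Over a field, every flag lies in the Borel orbit of some permuted standard flag. -/
lemma IsFlag.exists_eq_map_stdFlag [WellFoundedLT I] {F : I → Submodule K (Succs I →₀ K)}
    (hF : IsFlag F) : ∃ (σ : Equiv.Perm (Succs I)), ∃ b ∈ Borel (Succs I) K, F = fun i =>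
      ((stdFlag I K i).map (permMatrix (R := K) σ).toLinearMap).map b.toLinearMap := by
  choose p hp using fun j : Succs I => j.2
  -- `s j` is the unique lead acquired at the step from `p j` to `j`; it will be the permutation.
  choose s hs hs' using fun j : Succs I =>
    existsUnique_lead_of_finrank_eq_one (hF.mono (hp j).le) (hF.finrank_eq_one (hp j))
  -- Each lead of `F i` was acquired at a successor `≤ i`. At `exists_top` this gives surjectivity
  -- of `s`, and for general `i` the comparison of leads that ends the proof.
  have hsurj : ∀ i, ∀ m ∈ leads (F i), ∃ j : Succs I, j.1 ≤ i ∧ s j = m := by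
    intro i
    induction i using WellFoundedLT.induction with
    | ind i ih =>
      intro m hm
      have hlt : ∀ i' < i, m ∈ leads (F i') → ∃ j : Succs I, j.1 ≤ i ∧ s j = m := by
        intro i' hi' hm'
        obtain ⟨j, hj, e⟩ := ih i' hi' m hm'
        exact ⟨j, hj.trans hi'.le, e⟩
      by_cases hi : ∃ j, j ⋖ i
      · by_cases hm' : m ∈ leads (F (p ⟨i, hi⟩))
        · exact hlt _ (hp ⟨i, hi⟩).lt hm'
        · exact ⟨⟨i, hi⟩, le_rfl, (hs' ⟨i, hi⟩ m ⟨hm, hm'⟩).symm⟩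
      · obtain ⟨i', hi', hm'⟩ := hF.exists_mem_leads_of_limit hi hm
        exact hlt i' hi' hm'
  have hbij : Function.Bijective s := by
    constructor
    · have key : ∀ j j' : Succs I, s j = s j' → ¬ j < j' := by
        intro j j' e hlt
        exact (hs j').2 (e ▸ leads_mono (hF.mono ((hp j').le_of_lt hlt)) (hs j).1)
      exact fun j j' e => le_antisymm (not_lt.1 (key j' j e.symm)) (not_lt.1 (key j j' e))
    · intro m
      obtain ⟨q, hq⟩ := hF.exists_top
      obtain ⟨j, -, hj⟩ := hsurj q m
        ⟨Finsupp.single m 1, hq ▸ trivial, by simp, fun n hn => Finsupp.single_eq_of_ne hn.ne'⟩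
      exact ⟨j, hj⟩
  choose x hx hxs using fun j : Succs I => (hs j).1
  let σ := Equiv.ofBijective s hbij
  have hσ : ∀ j, σ j = s j := fun _ => rfl
  -- Column `σ j` is the vector `x j` with lead `σ j`, so `f` is upper triangular with nonzero
  -- diagonal and `f ∘ σ` sends `e_j` to `x j`.
  let f : (Succs I →₀ K) →ₗ[K] (Succs I →₀ K) :=
    Finsupp.linearCombination K fun m => x (σ.symm m)
  have hf : ∀ m, f (Finsupp.single m 1) = x (σ.symm m) := by
    intro m
    simp [f]
  have hlead : ∀ m, HasLead (f (Finsupp.single m 1)) m := by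
    intro m
    rw [hf]
    simpa [← hσ] using hxs (σ.symm m)
  refine ⟨σ, LinearEquiv.ofBijective f (bijective_of_hasLead hlead),
    fun i j hij => (hlead j).2 i hij, funext fun i => ?_⟩
  change F i = ((stdFlag I K i).map (permMatrix (R := K) σ).toLinearMap).map f
  have hle : ((stdFlag I K i).map (permMatrix (R := K) σ).toLinearMap).map f ≤ F i := by
    rw [map_permMatrix_stdFlag, Submodule.map_span, Submodule.span_le]
    rintro _ ⟨_, ⟨j, hj, rfl⟩, rfl⟩
    change f (Finsupp.single (σ j) 1) ∈ F i
    rw [hf, σ.symm_apply_apply]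
    exact hF.mono hj (hx j)
  refine le_antisymm (le_of_leads_subset hle fun m hm => ?_) hle
  rw [leads_map hlead, leads_map_permMatrix_stdFlag]
  exact hsurj i m hm

end Bruhat

/-! ### From fields to arbitrary algebras and fppf hulls -/

section Functors

variable {k : Type u} [CommRing k] {I : Type w} [LinearOrder I]

lemma borelOrbit_le_schubertCell (σ : Equiv.Perm (Succs I)) (R : CommAlgCat.{v} k) :
    (borelOrbit.{u, v, w} (k := k) σ).obj R ⊆ (schubertCell σ).obj R := by
  intro F hF
  refine ⟨R, 𝟙 R, RingHom.FaithfullyFlat.of_bijective Function.bijective_id, RingHom.FinitePresentation.id R, ?_⟩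
  rwa [Functor.map_id_apply]

/-- Orbits are stable under base change, so the residue field at a maximal ideal decides. -/
lemma perm_eq_of_mem_borelOrbit [WellFoundedLT I] {σ τ : Equiv.Perm (Succs I)} {R : CommAlgCat.{v} k}
    [Nontrivial R] {F : (Fl.{u, v, w} k I).obj R} (hσ : F ∈ (borelOrbit σ).obj R)
    (hτ : F ∈ (borelOrbit τ).obj R) : σ = τ := by
  obtain ⟨m, hm⟩ := Ideal.exists_maximal R
  let := Ideal.Quotient.field m
  let π : R ⟶ CommAlgCat.of k (R ⧸ m) := CommAlgCat.ofHom (Ideal.Quotient.mkₐ k m)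
  obtain ⟨b, hb, eb⟩ := (borelOrbit σ).map π hσ
  obtain ⟨c, hc, ec⟩ := (borelOrbit τ).map π hτ
  have e := eb.symm.trans ec
  exact perm_eq_of_map_stdFlag_eq (K := R ⧸ m) hb hc fun i => congrFun e i

lemma perm_eq_of_mem_schubertCell [WellFoundedLT I] {σ τ : Equiv.Perm (Succs I)} {R : CommAlgCat.{v} k}
    [Nontrivial R] {F : (Fl.{u, v, w} k I).obj R} (hσ : F ∈ (schubertCell σ).obj R)
    (hτ : F ∈ (schubertCell τ).obj R) : σ = τ := by
  obtain ⟨S, φ, hφ, -, hS⟩ := hσ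
  obtain ⟨T, ψ, hψ, -, hT⟩ := hτ
  let : Algebra R S := φ.hom.toRingHom.toAlgebra
  let : Algebra R T := ψ.hom.toRingHom.toAlgebra
  have : IsScalarTower k R S := IsScalarTower.of_algebraMap_eq fun a => (φ.hom.commutes a).symm
  have : IsScalarTower k R T := IsScalarTower.of_algebraMap_eq fun a => (ψ.hom.commutes a).symm
  have : Module.FaithfullyFlat R S := hφ
  have : Module.FaithfullyFlat R T := hψ
  have : Nontrivial T := (FaithfulSMul.algebraMap_injective R T).nontrivial
  let U : CommAlgCat.{v} k := CommAlgCat.of k (S ⊗[R] T)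
  -- `T` is nonzero and `S` is faithfully flat over `R`, so the common refinement of the two covers
  -- does not vanish.
  have : Nontrivial U := inferInstanceAs (Nontrivial (S ⊗[R] T))
  let α : S ⟶ U := CommAlgCat.ofHom
    ((Algebra.TensorProduct.includeLeft : S →ₐ[R] S ⊗[R] T).restrictScalars k)
  let β : T ⟶ U := CommAlgCat.ofHom
    ((Algebra.TensorProduct.includeRight : T →ₐ[R] S ⊗[R] T).restrictScalars k)
  have hcomm : φ ≫ α = ψ ≫ β := by
    ext a
    exact ((Algebra.TensorProduct.includeLeft : S →ₐ[R] S ⊗[R] T).commutes a).trans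
      ((Algebra.TensorProduct.includeRight : T →ₐ[R] S ⊗[R] T).commutes a).symm
  refine perm_eq_of_mem_borelOrbit ((borelOrbit σ).map α hS) ?_
  have : (Fl k I).map α ((Fl k I).map φ F) = (Fl k I).map β ((Fl k I).map ψ F) := by
    rw [← Functor.map_comp_apply, hcomm, Functor.map_comp_apply]
  rw [this]
  exact (borelOrbit τ).map β hT

end Functors

end FlagSpace

theorem mainTheorem1 {k : Type u} [CommRing k] {I : Type w} [LinearOrder I] [WellFoundedLT I] :
    (∀ σ τ : Equiv.Perm (FlagSpace.Succs I), σ ≠ τ →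
      FlagSpace.SubfunctorsDisjoint
        (FlagSpace.schubertCell.{u, v, w} (k := k) σ) (FlagSpace.schubertCell.{u, v, w} τ)) ∧
    FlagSpace.SubfunctorsCover
      (fun σ : Equiv.Perm (FlagSpace.Succs I) =>
        FlagSpace.schubertCell.{u, v, w} (k := k) σ) := by
  refine ⟨fun σ τ hστ R _ => Set.disjoint_left.2 fun F hσ hτ =>
    hστ (FlagSpace.perm_eq_of_mem_schubertCell hσ hτ), fun R hR => Set.eq_univ_of_forall ?_⟩
  rintro ⟨F, hF⟩
  let := hR.toField
  obtain ⟨σ, hσ⟩ := FlagSpace.IsFlag.exists_eq_map_stdFlag (K := R) hF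
  exact Set.mem_iUnion.2 ⟨σ, FlagSpace.borelOrbit_le_schubertCell σ R hσ⟩
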